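/- Let $\Gamma=(K,I,J,g,q)$ be a two-player zero-sum stochastic game with finite state set $K$, finite action sets $I$ (Player 1, the maximizer) and $J$ (Player 2), payoff $g:K\times I\times J\to\mathbb R$ and transition function $q:K\times I\times J\to\Delta(K)$, where $\Delta(X)$ is the set of probability distributions on $X$. For $\lambda\in(0,1]$, $k\in K$ and (history-dependent, behavioural) strategies $\sigma^1,\sigma^2$ let $$\gamma_\lambda(k,\sigma^1,\sigma^2)=\mathbb E^k_{\sigma^1,\sigma^2}\Big[\sum_{m\ge1}\lambda(1-\lambda)^{m-1}g(k_m,i_m,j_m)\Big],\qquad v_\lambda(k)=\max_{\sigma^1}\min_{\sigma^2}\gamma_\lambda(k,\sigma^1,\sigma^2)=\min_{\sigma^2}\max_{\sigma^1}\gamma_\lambda(k,\sigma^1,\sigma^2)$$ be the expected $\lambda$-discounted payoff from the initial state $k$ and the value; a strategy of Player 1 (resp. 2) is optimal if it realizes the outer maximum (resp. outer minimum). Let $(x^1_\lambda,x^2_\lambda)_{\lambda\in(0,1]}$ be an optimal Puiseux strategy profile: $x^1_\lambda:K\to\Delta(I)$ and $x^2_\lambda:K\to\Delta(J)$ are stationary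 strategies that are optimal in the $\lambda$-discounted game from every initial state, and there are $\lambda_0\in(0,1]$ and an integer $N\ge1$ such that each of the functions $\lambda\mapsto x^1_\lambda(k,i)$ and $\lambda\mapsto x^2_\lambda(k,j)$ is the sum of a convergent series $\sum_{m\ge0}a_m\lambda^{m/N}$ on $(0,\lambda_0)$. For $\lambda,\lambda',\lambda''\in(0,1]$ let $\Pi^k_{\lambda,\lambda',\lambda''}\in\Delta(K)$ be the occupation measure $$\Pi^k_{\lambda,\lambda',\lambda''}(\ell)=\mathbb E^k_{x^1_{\lambda'},x^2_{\lambda''}}\Big[\sum_{m\ge1}\lambda(1-\lambda)^{m-1}\mathbf 1_{\{k_m=\ell\}}\Big]\quad(\ell\in K),\qquad \langle \Pi,v\rangle=\sum_{\ell\in K}\Pi(\ell)v(\ell).$$ Then for every $k\in K$: (i) for all $0<\lambda'<\lambda\le1$, $$v_{\lambda'}(k)\ \ge\ \frac{\lambda'(1-\lambda)}{\lambda(1-\lambda')}\,v_\lambda(k)+\frac{\lambda-\lambda'}{\lambda(1-\lambda')}\,\langle\Pi^k_{\lambda,\lambda,\lambda'},v_{\lambda'}\rangle;$$ (ii) for all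 $0<\lambda'<\lambda\le1$, $$v_{\lambda'}(k)\ \le\ \frac{\lambda'(1-\lambda)}{\lambda(1-\lambda')}\,v_\lambda(k)+\frac{\lambda-\lambda'}{\lambda(1-\lambda')}\,\langle\Pi^k_{\lambda,\lambda',\lambda},v_{\lambda'}\rangle;$$ (iii) for every $\lambda\in(0,\lambda_0)$ the function $\lambda\mapsto v_\lambda(k)$ is differentiable at $\lambda$ and $$\frac{\partial}{\partial\lambda}v_\lambda(k)=\frac{1}{\lambda(1-\lambda)}\Big(v_\lambda(k)-\langle\Pi^k_{\lambda,\lambda,\lambda},v_\lambda\rangle\Big).$$ The two weights in (i) and (ii) add up to $1$; the second is positive, and the first is positive if $\lambda<1$ (and $0$ if $\lambda=1$). -/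

import Mathlib

open MeasureTheory ProbabilityTheory

noncomputable section

namespace StochGame

universe u v w

/-- A finite two-player zero-sum stochastic game with state set `K`, action sets `I` (Player 1,
the maximizer) and `J` (Player 2): stage payoff `g` and transition function `q : K × I × J → Δ(K)`.
Finiteness of `K`, `I`, `J` is carried by `Fintype` instances. -/
structure Game (K : Type u) (I : Type v) (J : Type w) [Fintype K] where
  g : K → I → J → ℝ
  q : K → I → J → stdSimplex ℝ K

/-- What is recorded at one stage: the state and the two actions, `(k_m, i_m, j_m)`. -/
def Stage (K : Type u) (I : Type v) (J : Type w) := K × I × J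

instance instFintypeStage (K : Type u) (I : Type v) (J : Type w) [Fintype K] [Fintype I]
    [Fintype J] : Fintype (Stage K I J) :=
  inferInstanceAs (Fintype (K × I × J))

instance instMeasurableSpaceStage (K : Type u) (I : Type v) (J : Type w) :
    MeasurableSpace (Stage K I J) := ⊤

instance instDiscreteStage (K : Type u) (I : Type v) (J : Type w) :
    DiscreteMeasurableSpace (Stage K I J) := ⟨fun _ => trivial⟩

/-- The state, the action of Player 1 and the action of Player 2 at a stage. -/
def Stage.state {K : Type u} {I : Type v} {J : Type w} (s : Stage K I J) : K := s.1
def Stage.act1 {K : Type u} {I : Type v} {J : Type w} (s : Stage K I J) : I := s.2.1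
def Stage.act2 {K : Type u} {I : Type v} {J : Type w} (s : Stage K I J) : J := s.2.2

/-- A (behavioural) strategy of Player 1. Stages are numbered from `0`; at stage `m` the mixed action
depends on the `m` past stages and on the current state. -/
abbrev Strategy1 (K : Type u) (I : Type v) (J : Type w) [Fintype I] :=
  (m : ℕ) → (Fin m → Stage K I J) → K → stdSimplex ℝ I

/-- A (behavioural) strategy of Player 2. -/
abbrev Strategy2 (K : Type u) (I : Type v) (J : Type w) [Fintype J] :=
  (m : ℕ) → (Fin m → Stage K I J) → K → stdSimplex ℝ J

/-- The strategy of Player 1 that plays the stationary strategy `x : K → Δ(I)`. -/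
def stat1 {K : Type u} {I : Type v} (J : Type w) [Fintype I] (x : K → stdSimplex ℝ I) :
    Strategy1 K I J := fun _ _ k => x k

/-- The strategy of Player 2 that plays the stationary strategy `x : K → Δ(J)`. -/
def stat2 {K : Type u} (I : Type v) {J : Type w} [Fintype J] (x : K → stdSimplex ℝ J) :
    Strategy2 K I J := fun _ _ k => x k

section Play

variable {K : Type u} {I : Type v} {J : Type w} [Fintype K] [Fintype I] [Fintype J]

/-- The law of `(k, i, j)` when `k` has law `ν` and, given `k`, the actions `i`, `j` are drawn
independently from `a k` and `b k`. -/
def stageLaw (ν : stdSimplex ℝ K) (a : K → stdSimplex ℝ I) (b : K → stdSimplex ℝ J) :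
    PMF (Stage K I J) :=
  PMF.ofFintype
    (fun s => ENNReal.ofReal (ν.1 s.state * ((a s.state).1 s.act1 * (b s.state).1 s.act2)))
    (by
      rw [← ENNReal.ofReal_sum_of_nonneg
        (fun s _ => mul_nonneg (ν.2.1 _) (mul_nonneg ((a _).2.1 _) ((b _).2.1 _)))]
      rw [← ENNReal.ofReal_one]
      congr 1
      change ∑ s : K × I × J, ν.1 s.1 * ((a s.1).1 s.2.1 * (b s.1).1 s.2.2) = 1
      simp only [Fintype.sum_prod_type, ← Finset.mul_sum]
      simp only [(b _).2.2, mul_one, (a _).2.2, ν.2.2])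

/-- The Dirac mass at `k`, as an element of `Δ(K)`. -/
def diracSimplex (k : K) : stdSimplex ℝ K := by
  classical
  exact ⟨Pi.single k 1, single_mem_stdSimplex ℝ k⟩

/-- The past `h_0, …, h_n`, as a sequence of `n + 1` stages. -/
def past (n : ℕ) (h : Finset.Iic n → Stage K I J) : Fin (n + 1) → Stage K I J :=
  fun l => h ⟨l.1, Finset.mem_Iic.2 (Nat.lt_succ_iff.1 l.2)⟩

/-- The law of stage `n + 1` given the stages `0, …, n`. -/
def stepKernel (G : Game K I J) (σ : Strategy1 K I J) (τ : Strategy2 K I J) (n : ℕ) :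
    Kernel (Finset.Iic n → Stage K I J) (Stage K I J) where
  toFun h := (stageLaw
    (G.q (h ⟨n, Finset.mem_Iic.2 le_rfl⟩).state (h ⟨n, Finset.mem_Iic.2 le_rfl⟩).act1
      (h ⟨n, Finset.mem_Iic.2 le_rfl⟩).act2)
    (σ (n + 1) (past n h)) (τ (n + 1) (past n h))).toMeasure
  measurable' := Measurable.of_discrete

instance instMarkovStepKernel (G : Game K I J) (σ : Strategy1 K I J) (τ : Strategy2 K I J) (n : ℕ) :
    IsMarkovKernel (stepKernel G σ τ n) :=
  ⟨fun _ => PMF.toMeasure.isProbabilityMeasure _⟩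

/-- The law of stage `0` when the initial state is `k`. -/
def initLaw (k : K) (σ : Strategy1 K I J) (τ : Strategy2 K I J) : Measure (Stage K I J) :=
  (stageLaw (diracSimplex k) (σ 0 Fin.elim0) (τ 0 Fin.elim0)).toMeasure

instance instProbInitLaw (k : K) (σ : Strategy1 K I J) (τ : Strategy2 K I J) :
    IsProbabilityMeasure (initLaw k σ τ) :=
  PMF.toMeasure.isProbabilityMeasure _

/-- The probability on plays `ℙ^k_{σ,τ}` (by the Ionescu-Tulcea theorem). -/
def playLaw (G : Game K I J) (k : K) (σ : Strategy1 K I J) (τ : Strategy2 K I J) :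
    Measure (ℕ → Stage K I J) :=
  Kernel.trajMeasure (X := fun _ => Stage K I J) (initLaw k σ τ) (stepKernel G σ τ)

/-- The expected `lam`-discounted payoff `γ_lam(k, σ, τ)`; the weight of stage `m`, numbered from
`0`, is `lam * (1 - lam) ^ m`. -/
def payoff (G : Game K I J) (lam : ℝ) (k : K) (σ : Strategy1 K I J) (τ : Strategy2 K I J) : ℝ :=
  ∫ ω, ∑' m : ℕ, lam * (1 - lam) ^ m * G.g (ω m).state (ω m).act1 (ω m).act2 ∂(playLaw G k σ τ)

/-- The value `v_lam(k)` of the `lam`-discounted game, as the max-min over all strategies. -/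
def value (G : Game K I J) (lam : ℝ) (k : K) : ℝ :=
  ⨆ σ : Strategy1 K I J, ⨅ τ : Strategy2 K I J, payoff G lam k σ τ

/-- The min-max over all strategies of the `lam`-discounted game. -/
def minmax (G : Game K I J) (lam : ℝ) (k : K) : ℝ :=
  ⨅ τ : Strategy2 K I J, ⨆ σ : Strategy1 K I J, payoff G lam k σ τ

/-- `σ` is optimal for Player 1: it realizes the outer maximum in the max-min. -/
def IsOptimal1 (G : Game K I J) (lam : ℝ) (k : K) (σ : Strategy1 K I J) : Prop :=
  ⨅ τ : Strategy2 K I J, payoff G lam k σ τ = value G lam k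

/-- `τ` is optimal for Player 2: it realizes the outer minimum in the min-max. -/
def IsOptimal2 (G : Game K I J) (lam : ℝ) (k : K) (τ : Strategy2 K I J) : Prop :=
  ⨆ σ : Strategy1 K I J, payoff G lam k σ τ = minmax G lam k

/-- `f` is the sum of a Puiseux series `∑ a_m t^(m/N)` on `(0, lam₀)`. -/
def IsPuiseuxOn (N : ℕ) (lam₀ : ℝ) (f : ℝ → ℝ) : Prop :=
  ∃ a : ℕ → ℝ, ∀ t ∈ Set.Ioo (0 : ℝ) lam₀,
    HasSum (fun m : ℕ => a m * t ^ ((m : ℝ) / (N : ℝ))) (f t)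

/-- `(x1 lam, x2 lam)`, for `lam ∈ (0,1]`, is an optimal Puiseux strategy profile: both are optimal
stationary strategies (from every initial state) and their coordinates are Puiseux series on
`(0, lam₀)` with common denominator `N`. The values of `x1`, `x2` outside `(0,1]` are irrelevant. -/
structure IsOptimalPuiseuxProfile (G : Game K I J) (x1 : ℝ → K → stdSimplex ℝ I)
    (x2 : ℝ → K → stdSimplex ℝ J) (lam₀ : ℝ) (N : ℕ) : Prop where
  lam₀_mem : lam₀ ∈ Set.Ioc (0 : ℝ) 1
  N_pos : 1 ≤ N
  optimal1 : ∀ lam ∈ Set.Ioc (0 : ℝ) 1, ∀ k, IsOptimal1 G lam k (stat1 J (x1 lam))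
  optimal2 : ∀ lam ∈ Set.Ioc (0 : ℝ) 1, ∀ k, IsOptimal2 G lam k (stat2 I (x2 lam))
  puiseux1 : ∀ k i, IsPuiseuxOn N lam₀ (fun lam => (x1 lam k).1 i)
  puiseux2 : ∀ k j, IsPuiseuxOn N lam₀ (fun lam => (x2 lam k).1 j)

/-- The occupation measure `Π^k_{lam, lam', lam''}` of the states, with discount factor `lam`, when
Player 1 plays `x1 lam'` and Player 2 plays `x2 lam''`, as a vector indexed by the states. -/
def occ (G : Game K I J) (x1 : ℝ → K → stdSimplex ℝ I) (x2 : ℝ → K → stdSimplex ℝ J)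
    (lam lam' lam'' : ℝ) (k : K) : K → ℝ := fun k' =>
  ∫ ω, ∑' m : ℕ, lam * (1 - lam) ^ m * Set.indicator {k'} 1 (ω m).state
    ∂(playLaw G k (stat1 J (x1 lam')) (stat2 I (x2 lam'')))

end Play

end StochGame

end

noncomputable section

namespace StochGame

universe u v w

/-! Everything rests on a comparison principle (`le_disc`, `disc_le`): a vector that lies below
(above) its image under the one-stage operator, with the mixed actions actually played, lies below
(above) the discounted payoff. It yields the Shapley value, and it shows that an optimal stationary
strategy is also optimal in each one-stage game with continuation `value` (`mixed_bellman_le`,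
`le_mixed_bellman`).

For (i), let P be the transition matrix of (x1 lam, x2 lam') and c the expected stage payoff.
One-stage optimality of x2 lam' says that w = v_lam' satisfies lam' c + (1 - lam') P w ≤ w. With u =
⟨Π_{lam,lam,lam'}, w⟩, which solves u = lam w + (1 - lam) P u, a combination of w and u is then
superharmonic for the discount factor lam, so it dominates the lam-payoff (`disc_add_disc_le`). That
payoff is at least v_lam because x1 lam is optimal. Exchanging the players gives (ii).

For (iii), subtracting and dividing by lam - lam' turns (i) and (ii) into upper and lower bounds on
the slope of the value. Both converge to the stated derivative, by continuity of the discounted sums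
in the discount factor and the strategies (`tendsto_disc`). The Puiseux expansions enter only
through continuity of the strategies on (0, lam₀). -/

theorem map_zero_trajMeasure {X : ℕ → Type*} [∀ n, MeasurableSpace (X n)] (μ₀ : Measure (X 0))
    [IsProbabilityMeasure μ₀] (κ : (n : ℕ) → Kernel ((i : Finset.Iic n) → X i) (X (n + 1)))
    [∀ n, IsMarkovKernel (κ n)] :
    (Kernel.trajMeasure μ₀ κ).map (fun x => x 0) = μ₀ := by
  have h : (fun x : (n : ℕ) → X n => x 0) =
      (fun y : (i : Finset.Iic 0) → X i => y ⟨0, Finset.mem_Iic.2 le_rfl⟩) ∘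
        Preorder.frestrictLe 0 := rfl
  rw [h, ← Measure.map_map (by fun_prop) (by fun_prop), Kernel.trajMeasure,
    Measure.map_comp _ _ (by fun_prop), Kernel.traj_map_frestrictLe, Kernel.partialTraj_self,
    Measure.id_comp]
  exact (Measure.map_map (μ := μ₀) (measurable_pi_apply _)
    (MeasurableEquiv.measurable _)).trans Measure.map_id

theorem measurable_stage {K : Type u} {I : Type v} {J : Type w} {Ω : Type*} [MeasurableSpace Ω]
    {f : Ω → Stage K I J} (hf : Measurable f) (F : K → I → J → ℝ) : Measurable fun ω => F (f ω).state (f ω).act1 (f ω).act2 :=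
  (Measurable.of_discrete (f := fun s : Stage K I J => F s.state s.act1 s.act2)).comp hf

/-! ### The one-stage operator -/

section Operator

variable {K : Type u} {I : Type v} {J : Type w} [Fintype K]

/-- The one-stage operator of the `lam`-discounted game with stage payoff `c` and continuation
payoff `w`. -/
def bellman (G : Game K I J) (lam : ℝ) (c : K → I → J → ℝ) (w : K → ℝ) (k : K) (i : I) (j : J) : ℝ :=
  lam * c k i j + (1 - lam) * ∑ l, (G.q k i j).1 l * w l

theorem bellman_neg (G : Game K I J) (lam : ℝ) (c : K → I → J → ℝ) (w : K → ℝ) (k : K) (i : I)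
    (j : J) : bellman G lam (fun k i j => - c k i j) (fun k => - w k) k i j
      = - bellman G lam c w k i j := by
  simp only [bellman, mul_neg, Finset.sum_neg_distrib]; ring

end Operator

/-! ### Mixed actions, stage expectations and the comparison principle -/

section Bellman

variable {K : Type u} {I : Type v} {J : Type w} [Fintype K] [Fintype I] [Fintype J]

/-- The bilinear extension of `F : I × J → ℝ` to mixed actions. -/
def mixed (a : stdSimplex ℝ I) (b : stdSimplex ℝ J) (F : I → J → ℝ) : ℝ :=
  ∑ i, ∑ j, a.1 i * b.1 j * F i j

theorem mixed_mono (a : stdSimplex ℝ I) (b : stdSimplex ℝ J) {F F' : I → J → ℝ}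
    (h : ∀ i j, F i j ≤ F' i j) : mixed a b F ≤ mixed a b F' :=
  Finset.sum_le_sum fun i _ => Finset.sum_le_sum fun j _ =>
    mul_le_mul_of_nonneg_left (h i j) (mul_nonneg (a.2.1 i) (b.2.1 j))

theorem mixed_add (a : stdSimplex ℝ I) (b : stdSimplex ℝ J) (F F' : I → J → ℝ) :
    mixed a b (fun i j => F i j + F' i j) = mixed a b F + mixed a b F' := by
  simp only [mixed, mul_add, Finset.sum_add_distrib]

theorem mixed_const_mul (a : stdSimplex ℝ I) (b : stdSimplex ℝ J) (c : ℝ) (F : I → J → ℝ) :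
    mixed a b (fun i j => c * F i j) = c * mixed a b F := by
  simp only [mixed, Finset.mul_sum]
  exact Finset.sum_congr rfl fun i _ => Finset.sum_congr rfl fun j _ => by ring

theorem mixed_neg (a : stdSimplex ℝ I) (b : stdSimplex ℝ J) (F : I → J → ℝ) :
    mixed a b (fun i j => - F i j) = - mixed a b F := by
  simp only [mixed, mul_neg, Finset.sum_neg_distrib]

theorem mixed_const (a : stdSimplex ℝ I) (b : stdSimplex ℝ J) (c : ℝ) :
    mixed a b (fun _ _ => c) = c := by
  simp only [mixed, ← Finset.sum_mul, ← Finset.mul_sum, b.2.2, mul_one, a.2.2, one_mul]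

theorem mixed_bellman (G : Game K I J) (lam : ℝ) (a : stdSimplex ℝ I) (b : stdSimplex ℝ J) (c : K → I → J → ℝ)
    (w : K → ℝ) (k : K) : mixed a b (bellman G lam c w k) =
      lam * mixed a b (c k) + (1 - lam) * mixed a b (fun i j => ∑ l, (G.q k i j).1 l * w l) := by
  rw [← mixed_const_mul, ← mixed_const_mul, ← mixed_add]; rfl

/-- The expected discounted sum of the stage payoffs `c`. -/
def disc (G : Game K I J) (lam : ℝ) (k : K) (σ : Strategy1 K I J) (τ : Strategy2 K I J)
    (c : K → I → J → ℝ) : ℝ :=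
  ∫ ω, ∑' m : ℕ, lam * (1 - lam) ^ m * c (ω m).state (ω m).act1 (ω m).act2 ∂(playLaw G k σ τ)

theorem integral_stageLaw (ν : stdSimplex ℝ K) (a : K → stdSimplex ℝ I) (b : K → stdSimplex ℝ J)
    (F : K → I → J → ℝ) :
    ∫ s, F s.state s.act1 s.act2 ∂(stageLaw ν a b).toMeasure
      = ∑ k, ν.1 k * mixed (a k) (b k) (F k) := by
  rw [PMF.integral_eq_sum]
  have h : ∀ s : Stage K I J, ((stageLaw ν a b) s).toReal =
      ν.1 s.state * ((a s.state).1 s.act1 * (b s.state).1 s.act2) := fun s => by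
    simp only [stageLaw, PMF.ofFintype_apply]
    exact ENNReal.toReal_ofReal
      (mul_nonneg (ν.2.1 _) (mul_nonneg ((a _).2.1 _) ((b _).2.1 _)))
  simp only [h, smul_eq_mul]
  change ∑ s : K × I × J, ν.1 s.1 * ((a s.1).1 s.2.1 * (b s.1).1 s.2.2) * F s.1 s.2.1 s.2.2 = _
  simp only [Fintype.sum_prod_type, mixed, Finset.mul_sum, mul_assoc]

instance instProbPlayLaw (G : Game K I J) (k : K) (σ : Strategy1 K I J) (τ : Strategy2 K I J) :
    IsProbabilityMeasure (playLaw G k σ τ) := by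
  unfold playLaw; infer_instance

theorem abs_stage_le (F : K → I → J → ℝ) (k : K) (i : I) (j : J) :
    |F k i j| ≤ ∑ k, ∑ i, ∑ j, |F k i j| :=
  (Finset.single_le_sum (f := fun j => |F k i j|) (fun _ _ => abs_nonneg _)
    (Finset.mem_univ j)).trans <|
  (Finset.single_le_sum (f := fun i => ∑ j, |F k i j|)
    (fun _ _ => Finset.sum_nonneg fun _ _ => abs_nonneg _) (Finset.mem_univ i)).trans
  (Finset.single_le_sum (f := fun k => ∑ i, ∑ j, |F k i j|)
    (fun _ _ => Finset.sum_nonneg fun _ _ => Finset.sum_nonneg fun _ _ => abs_nonneg _)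
    (Finset.mem_univ k))

theorem integrable_stage (G : Game K I J) (k : K) (σ : Strategy1 K I J) (τ : Strategy2 K I J)
    (F : K → I → J → ℝ) (n : ℕ) :
    Integrable (fun ω => F (ω n).state (ω n).act1 (ω n).act2) (playLaw G k σ τ) :=
  .of_bound (measurable_stage (measurable_pi_apply n) F).aestronglyMeasurable
    (∑ k, ∑ i, ∑ j, |F k i j|) (ae_of_all _ fun _ => abs_stage_le F _ _ _)

/-- The expected value of `F` at stage `n`. -/
def stageExp (G : Game K I J) (k : K) (σ : Strategy1 K I J) (τ : Strategy2 K I J)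
    (F : K → I → J → ℝ) (n : ℕ) : ℝ :=
  ∫ ω, F (ω n).state (ω n).act1 (ω n).act2 ∂(playLaw G k σ τ)

theorem stageExp_zero (G : Game K I J) (k : K) (σ : Strategy1 K I J) (τ : Strategy2 K I J)
    (F : K → I → J → ℝ) :
    stageExp G k σ τ F 0 = mixed (σ 0 Fin.elim0 k) (τ 0 Fin.elim0 k) (F k) := by
  classical
  have h : ∫ s : Stage K I J, F s.state s.act1 s.act2 ∂(playLaw G k σ τ).map (fun ω => ω 0)
      = stageExp G k σ τ F 0 :=
    integral_map (measurable_pi_apply 0).aemeasurable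
      (measurable_stage measurable_id F).aestronglyMeasurable
  rw [← h, playLaw, map_zero_trajMeasure, initLaw, integral_stageLaw]
  simp [diracSimplex, Pi.single_apply]

/-- The history up to stage n + 1 has as law the composition-product of the history law up to n with
`stepKernel`; the last stage is integrated out. -/
theorem stageExp_succ (G : Game K I J) (k : K) (σ : Strategy1 K I J) (τ : Strategy2 K I J)
    (F : K → I → J → ℝ) (n : ℕ) :
    stageExp G k σ τ F (n + 1) = ∫ ω, ∑ l, (G.q (ω n).state (ω n).act1 (ω n).act2).1 l *
      mixed (σ (n + 1) (fun m => ω m) l) (τ (n + 1) (fun m => ω m) l) (F l)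
        ∂(playLaw G k σ τ) := by
  have hm := Kernel.map_frestrictLe_trajMeasure_compProd_eq_map_trajMeasure
    (X := fun _ => Stage K I J) (κ := stepKernel G σ τ) (μ₀ := initLaw k σ τ) (a := n)
  have hF : Measurable fun p : (Finset.Iic n → Stage K I J) × Stage K I J =>
      F p.2.state p.2.act1 p.2.act2 := measurable_stage measurable_snd F
  have h1 : ∫ p : (Finset.Iic n → Stage K I J) × Stage K I J, F p.2.state p.2.act1 p.2.act2
      ∂((playLaw G k σ τ).map (fun x => (Preorder.frestrictLe n x, x (n + 1))))
      = stageExp G k σ τ F (n + 1) :=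
    integral_map (by fun_prop) hF.aestronglyMeasurable
  rw [← h1, playLaw, ← hm, Measure.integral_compProd, integral_map]
  · refine integral_congr_ae (ae_of_all _ fun ω => ?_)
    exact integral_stageLaw _ _ _ F
  · fun_prop
  · exact Measurable.of_discrete.aestronglyMeasurable
  · have : IsProbabilityMeasure ((Kernel.trajMeasure (X := fun _ => Stage K I J) (initLaw k σ τ)
        (stepKernel G σ τ)).map (Preorder.frestrictLe n)) :=
      Measure.isProbabilityMeasure_map (by fun_prop)
    exact .of_bound hF.aestronglyMeasurable (∑ k, ∑ i, ∑ j, |F k i j|)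
      (ae_of_all _ fun _ => abs_stage_le F _ _ _)

/-- Stage payoffs are bounded, so a geometric series dominates and sum and integral may be
exchanged. -/
theorem hasSum_disc (G : Game K I J) {lam : ℝ} (hlam : lam ∈ Set.Ioc (0 : ℝ) 1) (k : K)
    (σ : Strategy1 K I J) (τ : Strategy2 K I J) (c : K → I → J → ℝ) :
    HasSum (fun m => lam * (1 - lam) ^ m * stageExp G k σ τ c m) (disc G lam k σ τ c) := by
  have h0 : 0 ≤ 1 - lam := sub_nonneg.2 hlam.2
  have h1 : 1 - lam < 1 := by linarith [hlam.1]
  have := hasSum_integral_of_summable_integral_norm (μ := playLaw G k σ τ)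
    (F := fun m ω => lam * (1 - lam) ^ m * c (ω m).state (ω m).act1 (ω m).act2)
    (fun m => (integrable_stage G k σ τ c m).const_mul _) ?_
  · simp only [integral_const_mul] at this
    exact this
  · refine .of_nonneg_of_le (fun m => integral_nonneg fun _ => norm_nonneg _) (fun m => ?_)
      ((summable_geometric_of_lt_one h0 h1).mul_left (lam * ∑ k, ∑ i, ∑ j, |c k i j|))
    refine (integral_mono (g := fun _ => lam * (∑ k, ∑ i, ∑ j, |c k i j|) * (1 - lam) ^ m)
      ((integrable_stage G k σ τ c m).const_mul _).norm (integrable_const _) fun ω => ?_).trans_eq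
      (by simp)
    have := mul_le_mul_of_nonneg_left
      (abs_stage_le c (ω m).state (ω m).act1 (ω m).act2)
      (mul_nonneg hlam.1.le (pow_nonneg h0 m))
    simp only [Real.norm_eq_abs, abs_mul, abs_of_pos hlam.1, abs_of_nonneg (pow_nonneg h0 m)]
    linarith

/-- A vector that is below its one-stage image along all histories is below the discounted
payoff. -/
theorem le_disc (G : Game K I J) {lam : ℝ} (hlam : lam ∈ Set.Ioc (0 : ℝ) 1)
    (σ : Strategy1 K I J) (τ : Strategy2 K I J) (c : K → I → J → ℝ) (w : K → ℝ)
    (h : ∀ n past k, w k ≤ mixed (σ n past k) (τ n past k) (bellman G lam c w k)) (k : K) :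
    w k ≤ disc G lam k σ τ c := by
  have h0 : 0 ≤ 1 - lam := sub_nonneg.2 hlam.2
  have h1 : 1 - lam < 1 := by linarith [hlam.1]
  set W : K → I → J → ℝ := fun k _ _ => w k with hW
  -- The hypothesis holds at every history, so after conditioning on the past the integrand is
  -- pointwise nonnegative.
  have step : ∀ n, stageExp G k σ τ W n ≤ stageExp G k σ τ (bellman G lam c w) n := by
    intro n
    have hsub : stageExp G k σ τ (bellman G lam c w) n - stageExp G k σ τ W n =
        stageExp G k σ τ (fun k i j => bellman G lam c w k i j + -w k) n := by
      simp only [← sub_eq_add_neg]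
      exact (integral_sub (integrable_stage G k σ τ (bellman G lam c w) n)
        (integrable_stage G k σ τ W n)).symm
    rw [← sub_nonneg, hsub]
    cases n with
    | zero =>
      rw [stageExp_zero, mixed_add, mixed_const]
      linarith [h 0 Fin.elim0 k]
    | succ n =>
      rw [stageExp_succ]
      refine integral_nonneg fun ω => Finset.sum_nonneg fun l _ =>
        mul_nonneg ((G.q _ _ _).2.1 l) ?_
      rw [mixed_add, mixed_const]
      linarith [h (n + 1) (fun m => ω m) l]
  have hb : ∀ n, stageExp G k σ τ (bellman G lam c w) n =
      lam * stageExp G k σ τ c n + (1 - lam) * stageExp G k σ τ W (n + 1) := by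
    intro n
    rw [stageExp_succ]
    simp only [hW, mixed_const]
    have := integrable_stage G k σ τ c n
    have h2 := integrable_stage G k σ τ (fun k i j => ∑ l, (G.q k i j).1 l * w l) n
    rw [stageExp, stageExp, ← integral_const_mul, ← integral_const_mul,
      ← integral_add (this.const_mul _) (h2.const_mul _)]
    rfl
  -- The inequality is unrolled forward along a single play, so no continuation strategy or shifted
  -- play law is needed. The remainder vanishes geometrically.
  have hsum : ∀ n, w k ≤ ∑ m ∈ Finset.range n, lam * (1 - lam) ^ m * stageExp G k σ τ c m
      + (1 - lam) ^ n * stageExp G k σ τ W n := by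
    intro n
    induction n with
    | zero => simp [stageExp_zero, hW, mixed_const]
    | succ n ih =>
      have := mul_le_mul_of_nonneg_left ((step n).trans_eq (hb n)) (pow_nonneg h0 n)
      rw [Finset.sum_range_succ, pow_succ]
      linarith
  have hlim := ((hasSum_disc G hlam k σ τ c).tendsto_sum_nat).add
    (f := _) (g := fun n => (1 - lam) ^ n * stageExp G k σ τ W n) (b := 0) ?_
  · rw [add_zero] at hlim
    exact ge_of_tendsto' hlim hsum
  · refine squeeze_zero_norm (a := fun n => (1 - lam) ^ n * ∑ k, ∑ i, ∑ j, |W k i j|) (fun n => ?_)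
      (by simpa using (tendsto_pow_atTop_nhds_zero_of_lt_one h0 h1).mul_const _)
    rw [norm_mul, norm_pow, Real.norm_of_nonneg h0]
    refine mul_le_mul_of_nonneg_left ?_ (pow_nonneg h0 n)
    refine (norm_integral_le_of_norm_le_const (C := ∑ k, ∑ i, ∑ j, |W k i j|)
      (ae_of_all _ fun ω => abs_stage_le W (ω n).state (ω n).act1 (ω n).act2)).trans_eq (by simp)

theorem disc_neg (G : Game K I J) (lam : ℝ) (σ : Strategy1 K I J) (τ : Strategy2 K I J)
    (c : K → I → J → ℝ) (k : K) :
    disc G lam k σ τ (fun k i j => - c k i j) = - disc G lam k σ τ c := by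
  simp only [disc, mul_neg, tsum_neg, integral_neg]

/-- `le_disc` after changing the signs of `c` and `w`. -/
theorem disc_le (G : Game K I J) {lam : ℝ} (hlam : lam ∈ Set.Ioc (0 : ℝ) 1)
    (σ : Strategy1 K I J) (τ : Strategy2 K I J) (c : K → I → J → ℝ) (w : K → ℝ)
    (h : ∀ n past k, mixed (σ n past k) (τ n past k) (bellman G lam c w k) ≤ w k) (k : K) :
    disc G lam k σ τ c ≤ w k := by
  have := le_disc G hlam σ τ (fun k i j => - c k i j) (fun k => - w k) (fun n p k => ?_) k
  · rw [disc_neg] at this; linarith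
  · have e : bellman G lam (fun k i j => - c k i j) (fun k => - w k) k =
        fun i j => - bellman G lam c w k i j := by
      funext i j; exact bellman_neg ..
    rw [e, mixed_neg]
    exact neg_le_neg (h n p k)

end Bellman

/-! ### Existence of the value -/

/-- The von Neumann minimax theorem for matrix games. -/
theorem exists_matrix_value {I : Type v} {J : Type w} [Fintype I] [Fintype J] [Nonempty I]
    [Nonempty J] (F : I → J → ℝ) :
    ∃ (a : stdSimplex ℝ I) (b : stdSimplex ℝ J) (r : ℝ),
      (∀ b', r ≤ mixed a b' F) ∧ ∀ a', mixed a' b F ≤ r := by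
  classical
  -- The minimizer's vector is the first argument, as in the convention of Sion's saddle points.
  let f : (J → ℝ) → (I → ℝ) → ℝ := fun y x => ∑ i, ∑ j, x i * y j * F i j
  have hlin1 : ∀ x, ConvexOn ℝ (stdSimplex ℝ J) fun y => f y x := fun x =>
    ⟨convex_stdSimplex ℝ J, fun y _ z _ p q _ _ _ => le_of_eq (by
      simp only [f, Pi.add_apply, Pi.smul_apply, smul_eq_mul, Finset.mul_sum,
        ← Finset.sum_add_distrib]
      exact Finset.sum_congr rfl fun i _ => Finset.sum_congr rfl fun j _ => by ring)⟩
  have hlin2 : ∀ y, ConcaveOn ℝ (stdSimplex ℝ I) fun x => f y x := fun y =>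
    ⟨convex_stdSimplex ℝ I, fun x _ z _ p q _ _ _ => le_of_eq (by
      simp only [f, Pi.add_apply, Pi.smul_apply, smul_eq_mul, Finset.mul_sum,
        ← Finset.sum_add_distrib]
      exact Finset.sum_congr rfl fun i _ => Finset.sum_congr rfl fun j _ => by ring)⟩
  have neI : (stdSimplex ℝ I).Nonempty := ⟨_, single_mem_stdSimplex ℝ (Classical.arbitrary I)⟩
  have neJ : (stdSimplex ℝ J).Nonempty := ⟨_, single_mem_stdSimplex ℝ (Classical.arbitrary J)⟩
  obtain ⟨b, hb, a, ha, h⟩ := Sion.exists_isSaddlePointOn (f := f) neJ (convex_stdSimplex ℝ J)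
    (isCompact_stdSimplex ℝ J)
    (fun x _ => Continuous.lowerSemicontinuous (by fun_prop) |>.lowerSemicontinuousOn _)
    (fun x _ => (hlin1 x).quasiconvexOn) (convex_stdSimplex ℝ I) neI (isCompact_stdSimplex ℝ I)
    (fun y _ => Continuous.upperSemicontinuous (by fun_prop) |>.upperSemicontinuousOn _)
    (fun y _ => (hlin2 y).quasiconcaveOn)
  exact ⟨⟨a, ha⟩, ⟨b, hb⟩, f b a, fun b' => h b'.1 b'.2 a ha, fun a' => h b hb a'.1 a'.2⟩

section Shapley

variable {K : Type u} {I : Type v} {J : Type w} [Fintype K]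

theorem abs_transition_sub_le (p : stdSimplex ℝ K) (w w' : K → ℝ) :
    |∑ l, p.1 l * w l - ∑ l, p.1 l * w' l| ≤ dist w w' := by
  rw [← Finset.sum_sub_distrib]
  refine (Finset.abs_sum_le_sum_abs _ _).trans ?_
  calc ∑ l, |p.1 l * w l - p.1 l * w' l| ≤ ∑ l, p.1 l * dist w w' :=
        Finset.sum_le_sum fun l _ => by
          rw [← mul_sub, abs_mul, abs_of_nonneg (p.2.1 l)]
          exact mul_le_mul_of_nonneg_left (dist_le_pi_dist w w' l) (p.2.1 l)
    _ = dist w w' := by rw [← Finset.sum_mul, p.2.2, one_mul]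

/-- A discounted operator whose local evaluations `φ k` are monotone and nonexpansive has a fixed
point. -/
theorem exists_bellman_fixedPoint (G : Game K I J) {lam : ℝ} (hlam : lam ∈ Set.Ioc (0 : ℝ) 1)
    (c : K → I → J → ℝ) (φ : K → (I → J → ℝ) → ℝ)
    (hφ : ∀ k F F' (ε : ℝ), (∀ i j, F i j ≤ F' i j + ε) → φ k F ≤ φ k F' + ε) :
    ∃ w : K → ℝ, ∀ k, w k = φ k (bellman G lam c w k) := by
  have h0 : 0 ≤ 1 - lam := sub_nonneg.2 hlam.2
  let T : (K → ℝ) → K → ℝ := fun w k => φ k (bellman G lam c w k)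
  have hb : ∀ w w' k i j, bellman G lam c w k i j
      ≤ bellman G lam c w' k i j + (1 - lam) * dist w w' := fun w w' k i j => by
    have := mul_le_mul_of_nonneg_left
      ((le_abs_self _).trans (abs_transition_sub_le (G.q k i j) w w')) h0
    simp only [bellman]
    linarith
  have hT : ContractingWith (1 - lam).toNNReal T := by
    refine ⟨by rw [← NNReal.coe_lt_coe, Real.coe_toNNReal _ h0]; simp [hlam.1],
      LipschitzWith.of_dist_le_mul fun w w' => ?_⟩
    rw [Real.coe_toNNReal _ h0, dist_pi_le_iff (mul_nonneg h0 dist_nonneg)]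
    intro k
    have h1 := hφ k _ _ _ (hb w w' k)
    have h2 := hφ k _ _ _ (hb w' w k)
    rw [dist_comm w' w] at h2
    rw [Real.dist_eq, abs_sub_le_iff]
    constructor <;> linarith
  exact ⟨hT.fixedPoint, fun k => (congrFun hT.fixedPoint_isFixedPt k).symm⟩

variable [Fintype I] [Fintype J]

/-- Shapley's theorem: the one-stage games have a common solution. -/
theorem exists_shapley [Nonempty I] [Nonempty J] (G : Game K I J) {lam : ℝ}
    (hlam : lam ∈ Set.Ioc (0 : ℝ) 1) :
    ∃ (w : K → ℝ) (a : K → stdSimplex ℝ I) (b : K → stdSimplex ℝ J),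
      (∀ k b', w k ≤ mixed (a k) b' (bellman G lam G.g w k)) ∧
      ∀ k a', mixed a' (b k) (bellman G lam G.g w k) ≤ w k := by
  choose α β r h1 h2 using fun F : I → J → ℝ => exists_matrix_value F
  -- The matrix value is nonexpansive: `α F` against `β F'` compares `r F` with `r F'`.
  obtain ⟨w, hw⟩ := exists_bellman_fixedPoint G hlam G.g (fun _ => r) fun _ F F' ε h => by
    have := (mixed_mono (α F) (β F') h).trans_eq (mixed_add _ _ _ _)
    rw [mixed_const] at this
    linarith [h1 F (β F'), h2 F' (α F)]
  exact ⟨w, fun k => α (bellman G lam G.g w k), fun k => β (bellman G lam G.g w k),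
    fun k b' => (hw k).trans_le (h1 _ b'), fun k a' => (h2 _ a').trans_eq (hw k).symm⟩

/-- The constant vectors ±M are sub- and superharmonic. The uniform bound makes the real `⨆` and `⨅`
genuine suprema and infima; on unbounded sets they take a default value. -/
theorem abs_payoff_le (G : Game K I J) {lam : ℝ} (hlam : lam ∈ Set.Ioc (0 : ℝ) 1)
    (k : K) (σ : Strategy1 K I J) (τ : Strategy2 K I J) :
    |payoff G lam k σ τ| ≤ ∑ k, ∑ i, ∑ j, |G.g k i j| := by
  set M := ∑ k, ∑ i, ∑ j, |G.g k i j|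
  have hb : ∀ (r : ℝ) k i j, bellman G lam G.g (fun _ => r) k i j = lam * G.g k i j + (1 - lam) * r :=
    fun r k i j => by simp only [bellman, ← Finset.sum_mul, (G.q k i j).2.2, one_mul]
  rw [abs_le]
  constructor
  · refine le_disc G hlam σ τ G.g (fun _ => -M) (fun n p k => ?_) k
    refine (mixed_const (σ n p k) (τ n p k) (-M)).ge.trans (mixed_mono _ _ fun i j => ?_)
    rw [hb]
    nlinarith [(abs_le.1 (abs_stage_le G.g k i j)).1, hlam.1]
  · refine disc_le G hlam σ τ G.g (fun _ => M) (fun n p k => ?_) k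
    refine (mixed_mono _ _ fun i j => ?_).trans (mixed_const (σ n p k) (τ n p k) M).le
    rw [hb]
    nlinarith [(abs_le.1 (abs_stage_le G.g k i j)).2, hlam.1]

section Bounds

variable (G : Game K I J) {lam : ℝ} (hlam : lam ∈ Set.Ioc (0 : ℝ) 1) (k : K)

include hlam

theorem bddBelow_payoff (σ : Strategy1 K I J) :
    BddBelow (Set.range fun τ => payoff G lam k σ τ) :=
  ⟨_, Set.forall_mem_range.2 fun τ => (abs_le.1 (abs_payoff_le G hlam k σ τ)).1⟩

theorem bddAbove_payoff (τ : Strategy2 K I J) :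
    BddAbove (Set.range fun σ => payoff G lam k σ τ) :=
  ⟨_, Set.forall_mem_range.2 fun σ => (abs_le.1 (abs_payoff_le G hlam k σ τ)).2⟩

/-- The discounted game has a value. -/
theorem value_eq_minmax [Nonempty I] [Nonempty J] : value G lam k = minmax G lam k := by
  classical
  obtain ⟨w, a, b, ha, hb⟩ := exists_shapley G hlam
  have neI : Nonempty (stdSimplex ℝ I) := ⟨a k⟩
  have neJ : Nonempty (stdSimplex ℝ J) := ⟨b k⟩
  have h1 : ∀ τ, w k ≤ payoff G lam k (stat1 J a) τ := fun τ =>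
    le_disc G hlam _ _ _ w (fun n p k => ha k _) k
  have h2 : ∀ σ, payoff G lam k σ (stat2 I b) ≤ w k := fun σ =>
    disc_le G hlam _ _ _ w (fun n p k => hb k _) k
  refine le_antisymm ?_ ?_
  · exact ciSup_le fun σ => le_ciInf fun τ => (ciInf_le (bddBelow_payoff G hlam k σ) τ).trans
      (le_ciSup (bddAbove_payoff G hlam k τ) σ)
  · have hbB : BddBelow (Set.range fun τ => ⨆ σ, payoff G lam k σ τ) :=
      ⟨_, Set.forall_mem_range.2 fun τ => (abs_le.1 (abs_payoff_le G hlam k (stat1 J a) τ)).1.trans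
        (le_ciSup (bddAbove_payoff G hlam k τ) (stat1 J a))⟩
    have hbA : BddAbove (Set.range fun σ => ⨅ τ, payoff G lam k σ τ) :=
      ⟨_, Set.forall_mem_range.2 fun σ => (ciInf_le (bddBelow_payoff G hlam k σ) (stat2 I b)).trans
        (abs_le.1 (abs_payoff_le G hlam k σ (stat2 I b))).2⟩
    exact ((ciInf_le hbB (stat2 I b)).trans (ciSup_le h2)).trans
      ((le_ciInf h1).trans (le_ciSup hbA (stat1 J a)))

theorem IsOptimal1.value_le {σ : Strategy1 K I J} (h : IsOptimal1 G lam k σ)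
    (τ : Strategy2 K I J) : value G lam k ≤ payoff G lam k σ τ :=
  h.ge.trans (ciInf_le (bddBelow_payoff G hlam k σ) τ)

theorem IsOptimal2.le_value [Nonempty I] [Nonempty J] {τ : Strategy2 K I J}
    (h : IsOptimal2 G lam k τ) (σ : Strategy1 K I J) : payoff G lam k σ τ ≤ value G lam k :=
  ((le_ciSup (bddAbove_payoff G hlam k τ) σ).trans h.le).trans (value_eq_minmax G hlam k).ge

end Bounds

/-! ### Stationary strategies: recursion, one-stage optimality, change of discount factor -/

section Stationary

variable (G : Game K I J) {lam : ℝ} (hlam : lam ∈ Set.Ioc (0 : ℝ) 1)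
  (x : K → stdSimplex ℝ I) (y : K → stdSimplex ℝ J)

include hlam

/-- The stationary recursion for discounted sums. -/
theorem disc_stat (c : K → I → J → ℝ) (k : K) :
    disc G lam k (stat1 J x) (stat2 I y) c = mixed (x k) (y k)
      (bellman G lam c (fun l => disc G lam l (stat1 J x) (stat2 I y) c) k) := by
  -- The fixed point satisfies both comparison hypotheses with equality, hence is the discounted
  -- sum; the Markov property is not invoked.
  obtain ⟨w, hw⟩ := exists_bellman_fixedPoint G hlam c (fun k => mixed (x k) (y k))
    fun k F F' ε h => by
      have := (mixed_mono (x k) (y k) h).trans_eq (mixed_add _ _ _ _)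
      rwa [mixed_const] at this
  have : w = fun l => disc G lam l (stat1 J x) (stat2 I y) c := funext fun l =>
    le_antisymm (le_disc G hlam _ _ c w (fun _ _ k => (hw k).le) l)
      (disc_le G hlam _ _ c w (fun _ _ k => (hw k).ge) l)
  rw [← this, ← hw k]; exact (congrFun this k).symm

/-- Against a stationary optimal strategy of Player 2, no one-stage deviation is profitable. -/
theorem mixed_bellman_le {w : K → ℝ}
    (hw : ∀ k, payoff G lam k (stat1 J x) (stat2 I y) = w k)
    (hy : ∀ k σ, payoff G lam k σ (stat2 I y) ≤ w k) (k : K) (a : stdSimplex ℝ I) :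
    mixed a (y k) (bellman G lam G.g w k) ≤ w k := by
  classical
  by_contra! hlt
  have hw' : (fun l => disc G lam l (stat1 J x) (stat2 I y) G.g) = w := funext hw
  -- Switching to `a` at `k` alone leaves `w` subharmonic, so the deviation earns at least `w`.
  -- Optimality of `y` caps it at `w`, and the recursion at `k` then contradicts strictness.
  have hle : ∀ l, w l ≤ mixed (Function.update x k a l) (y l) (bellman G lam G.g w l) := fun l => by
    rcases eq_or_ne l k with rfl | hl
    · simpa using hlt.le
    · rw [Function.update_of_ne hl]
      have := disc_stat G hlam x y G.g l
      rw [hw'] at this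
      exact ((hw l).symm.trans this).le
  have heq : (fun l => disc G lam l (stat1 J (Function.update x k a)) (stat2 I y) G.g) = w :=
    funext fun l => le_antisymm (hy l _) (le_disc G hlam _ _ _ w (fun _ _ l => hle l) l)
  have := disc_stat G hlam (Function.update x k a) y G.g k
  rw [heq, Function.update_self] at this
  exact hlt.ne ((congrFun heq k).symm.trans this)

theorem le_mixed_bellman {w : K → ℝ}
    (hw : ∀ k, payoff G lam k (stat1 J x) (stat2 I y) = w k)
    (hx : ∀ k τ, w k ≤ payoff G lam k (stat1 J x) τ) (k : K) (b : stdSimplex ℝ J) :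
    w k ≤ mixed (x k) b (bellman G lam G.g w k) := by
  classical
  by_contra! hlt
  have hw' : (fun l => disc G lam l (stat1 J x) (stat2 I y) G.g) = w := funext hw
  have hle : ∀ l, mixed (x l) (Function.update y k b l) (bellman G lam G.g w l) ≤ w l := fun l => by
    rcases eq_or_ne l k with rfl | hl
    · simpa using hlt.le
    · rw [Function.update_of_ne hl]
      have := disc_stat G hlam x y G.g l
      rw [hw'] at this
      exact ((hw l).symm.trans this).ge
  have heq : (fun l => disc G lam l (stat1 J x) (stat2 I (Function.update y k b)) G.g) = w :=
    funext fun l => le_antisymm (disc_le G hlam _ _ _ w (fun _ _ l => hle l) l) (hx l _)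
  have := disc_stat G hlam x (Function.update y k b) G.g k
  rw [heq, Function.update_self] at this
  exact hlt.ne' ((congrFun heq k).symm.trans this)

/-- A vector that is superharmonic for the discount factor `lam'` bounds a weighted sum of
`lam`-discounted payoffs. -/
theorem disc_add_disc_le {lam' : ℝ} (h' : 0 < lam') (hlt : lam' < lam) (c : K → I → J → ℝ)
    (w : K → ℝ) (hw : ∀ k, mixed (x k) (y k) (bellman G lam' c w k) ≤ w k) (k : K) :
    (lam' * (1 - lam) / (lam * (1 - lam'))) * disc G lam k (stat1 J x) (stat2 I y) c
      + ((lam - lam') / (lam * (1 - lam'))) *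
        disc G lam k (stat1 J x) (stat2 I y) (fun l _ _ => w l) ≤ w k := by
  set u : K → ℝ := fun k => disc G lam k (stat1 J x) (stat2 I y) (fun l _ _ => w l) with hu
  have hrec : ∀ k, u k = lam * w k + (1 - lam) *
      mixed (x k) (y k) (fun i j => ∑ l, (G.q k i j).1 l * u l) := fun k => by
    have := disc_stat G hlam x y (fun l _ _ => w l) k
    rwa [mixed_bellman, mixed_const] at this
  have hl : 0 < lam := hlam.1
  have h1' : 0 < 1 - lam' := by linarith [hlam.2]
  rw [div_mul_eq_mul_div, div_mul_eq_mul_div, ← add_div, div_le_iff₀ (mul_pos hl h1')]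
  change _ + _ * u k ≤ _
  -- At lam = 1 the weight of `c` is 0 and `u = w`; this case is separate because `z` divides by 1 -
  -- lam.
  rcases hlam.2.eq_or_lt with rfl | h1
  · rw [hrec k]; apply le_of_eq; ring
  have h1 : 0 < 1 - lam := sub_pos.2 h1
  -- `z` is the claimed inequality solved for the payoff of `c`. Its superharmonicity for lam is
  -- `hw` times lam / lam', with the same multiple of `pu` subtracted on both sides.
  set z : K → ℝ := fun k => (lam * (1 - lam')) / (lam' * (1 - lam)) * w k
    + (-((lam - lam') / (lam' * (1 - lam)))) * u k with hz
  have key := disc_le G hlam (stat1 J x) (stat2 I y) c z (fun _ _ k => ?_) k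
  · have := mul_le_mul_of_nonneg_left key (mul_pos h' h1).le
    simp only [hz] at this
    field_simp at this
    change _ + _ * u k ≤ _
    linarith
  · change mixed (x k) (y k) _ ≤ _
    have hP : mixed (x k) (y k) (fun i j => ∑ l, (G.q k i j).1 l * z l) =
        (lam * (1 - lam')) / (lam' * (1 - lam)) *
          mixed (x k) (y k) (fun i j => ∑ l, (G.q k i j).1 l * w l)
        + (-((lam - lam') / (lam' * (1 - lam)))) *
          mixed (x k) (y k) (fun i j => ∑ l, (G.q k i j).1 l * u l) := by
      rw [← mixed_const_mul, ← mixed_const_mul, ← mixed_add]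
      congr; funext i j
      simp only [hz, Finset.mul_sum, ← Finset.sum_add_distrib]
      exact Finset.sum_congr rfl fun l _ => by ring
    have h2 := hw k
    have h3 := hrec k
    rw [mixed_bellman] at h2 ⊢
    rw [hP]
    simp only [hz]
    generalize mixed (x k) (y k) (fun i j => ∑ l, (G.q k i j).1 l * w l) = pw at *
    generalize mixed (x k) (y k) (fun i j => ∑ l, (G.q k i j).1 l * u l) = pu at *
    generalize mixed (x k) (y k) (c k) = r at *
    rw [h3]
    have h4 := mul_le_mul_of_nonneg_left h2 (div_pos hl h').le
    have e : lam * r + (1 - lam) * (lam * (1 - lam') / (lam' * (1 - lam)) * pw +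
        -((lam - lam') / (lam' * (1 - lam))) * pu) =
        lam / lam' * (lam' * r + (1 - lam') * pw) - (lam - lam') / lam' * pu := by
      field_simp
      ring
    have e2 : lam * (1 - lam') / (lam' * (1 - lam)) * w k +
        -((lam - lam') / (lam' * (1 - lam))) * (lam * w k + (1 - lam) * pu) =
        lam / lam' * w k - (lam - lam') / lam' * pu := by
      field_simp
      ring
    rw [e, e2]
    linarith

/-- `disc_add_disc_le` with `c` and `w` negated. -/
theorem le_disc_add_disc {lam' : ℝ} (h' : 0 < lam') (hlt : lam' < lam) (c : K → I → J → ℝ)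
    (w : K → ℝ) (hw : ∀ k, w k ≤ mixed (x k) (y k) (bellman G lam' c w k)) (k : K) :
    w k ≤ (lam' * (1 - lam) / (lam * (1 - lam'))) * disc G lam k (stat1 J x) (stat2 I y) c
      + ((lam - lam') / (lam * (1 - lam'))) *
        disc G lam k (stat1 J x) (stat2 I y) (fun l _ _ => w l) := by
  have := disc_add_disc_le G hlam x y h' hlt (fun k i j => - c k i j) (fun k => - w k)
    (fun k => ?_) k
  · rw [disc_neg, disc_neg G lam _ _ (fun l _ _ => w l)] at this
    linarith
  · have e : bellman G lam' (fun k i j => - c k i j) (fun k => - w k) k =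
        fun i j => - bellman G lam' c w k i j := by
      funext i j; exact bellman_neg ..
    rw [e, mixed_neg]
    exact neg_le_neg (hw k)

/-- The distance from a vector to the discounted payoff is controlled by its Bellman defect. -/
theorem abs_disc_sub_le (c : K → I → J → ℝ) (w : K → ℝ) (k : K) :
    |disc G lam k (stat1 J x) (stat2 I y) c - w k| ≤
      (∑ l, |mixed (x l) (y l) (bellman G lam c w l) - w l|) / lam := by
  set ε := ∑ l, |mixed (x l) (y l) (bellman G lam c w l) - w l| with hε
  have hl : ∀ l, |mixed (x l) (y l) (bellman G lam c w l) - w l| ≤ ε := fun l =>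
    Finset.single_le_sum (f := fun l => |mixed (x l) (y l) (bellman G lam c w l) - w l|)
      (fun _ _ => abs_nonneg _) (Finset.mem_univ l)
  -- Raising `w` by d raises its image by only (1 - lam) d. The gain lam d absorbs the defect ε when
  -- d = ε / lam.
  have hshift : ∀ (d : ℝ) l, mixed (x l) (y l) (bellman G lam c (fun l => w l + d) l) =
      mixed (x l) (y l) (bellman G lam c w l) + (1 - lam) * d := fun d l => by
    have : bellman G lam c (fun l => w l + d) l =
        fun i j => bellman G lam c w l i j + (1 - lam) * d := by
      funext i j
      simp only [bellman, mul_add, Finset.sum_add_distrib, ← Finset.sum_mul, (G.q l i j).2.2]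
      ring
    rw [this, mixed_add, mixed_const]
  have hd : lam * (ε / lam) = ε := mul_div_cancel₀ _ hlam.1.ne'
  have h1 := disc_le G hlam (stat1 J x) (stat2 I y) c (fun l => w l + ε / lam) (fun _ _ l => by
    refine (hshift _ l).trans_le ?_
    linarith [(abs_le.1 (hl l)).2]) k
  have h2 := le_disc G hlam (stat1 J x) (stat2 I y) c (fun l => w l + -(ε / lam)) (fun _ _ l => by
    refine le_of_le_of_eq ?_ (hshift _ l).symm
    linarith [(abs_le.1 (hl l)).1]) k
  rw [abs_le]
  constructor <;> linarith

end Stationary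

/-- Freeze `w` at the limiting discounted sum. Its Bellman defect under the varying data is a finite
continuous expression that vanishes in the limit, and `abs_disc_sub_le` converts this into
convergence, without any limit of play laws. -/
theorem tendsto_disc (G : Game K I J) {ι : Type*} {f : Filter ι} {lam : ℝ} {L : ι → ℝ}
    (hlam : lam ∈ Set.Ioc (0 : ℝ) 1) (hL : Filter.Tendsto L f (nhds lam))
    (hL1 : ∀ᶠ n in f, L n ≤ 1)
    {x : K → stdSimplex ℝ I} {y : K → stdSimplex ℝ J} {X : ι → K → stdSimplex ℝ I}
    {Y : ι → K → stdSimplex ℝ J}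
    (hX : ∀ k i, Filter.Tendsto (fun n => (X n k).1 i) f (nhds ((x k).1 i)))
    (hY : ∀ k j, Filter.Tendsto (fun n => (Y n k).1 j) f (nhds ((y k).1 j)))
    (c : K → I → J → ℝ) (k : K) :
    Filter.Tendsto (fun n => disc G (L n) k (stat1 J (X n)) (stat2 I (Y n)) c) f
      (nhds (disc G lam k (stat1 J x) (stat2 I y) c)) := by
  set w : K → ℝ := fun l => disc G lam l (stat1 J x) (stat2 I y) c with hw
  have hfix : ∀ l, mixed (x l) (y l) (bellman G lam c w l) - w l = 0 := fun l =>
    sub_eq_zero.2 (disc_stat G hlam x y c l).symm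
  have hlim : Filter.Tendsto (fun n => (∑ l, |mixed (X n l) (Y n l) (bellman G (L n) c w l) - w l|)
      / L n) f (nhds ((∑ l, |mixed (x l) (y l) (bellman G lam c w l) - w l|) / lam)) := by
    refine Filter.Tendsto.div (tendsto_finsetSum _ fun l _ => ?_) hL hlam.1.ne'
    refine ((tendsto_finsetSum _ fun i _ => tendsto_finsetSum _ fun j _ =>
      ((hX l i).mul (hY l j)).mul ?_).sub_const _).abs
    exact (hL.mul_const _).add ((hL.const_sub 1).mul_const _)
  simp only [hfix, abs_zero, Finset.sum_const_zero, zero_div] at hlim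
  rw [tendsto_iff_norm_sub_tendsto_zero]
  refine squeeze_zero' (.of_forall fun _ => norm_nonneg _) ?_ hlim
  filter_upwards [hL1, hL.eventually (lt_mem_nhds hlam.1)] with n h1 h0
  exact abs_disc_sub_le G ⟨h0, h1⟩ (X n) (Y n) c w k

/-- Pairing with the occupation measure becomes a discounted sum with stage payoff `w`, to which the
comparison and continuity results apply. -/
theorem occ_dotProduct (G : Game K I J) (x1 : ℝ → K → stdSimplex ℝ I)
    (x2 : ℝ → K → stdSimplex ℝ J) {lam : ℝ} (hlam : lam ∈ Set.Ioc (0 : ℝ) 1) (lam' lam'' : ℝ)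
    (k : K) (w : K → ℝ) :
    occ G x1 x2 lam lam' lam'' k ⬝ᵥ w =
      disc G lam k (stat1 J (x1 lam')) (stat2 I (x2 lam'')) (fun l _ _ => w l) := by
  classical
  set σ := stat1 J (x1 lam')
  set τ := stat2 I (x2 lam'')
  have h1 : ∀ l, occ G x1 x2 lam lam' lam'' k l =
      disc G lam k σ τ (fun k' _ _ => Set.indicator {l} 1 k') := fun l => rfl
  have h2 := hasSum_sum (s := Finset.univ) fun l _ =>
    (hasSum_disc G hlam k σ τ (fun k' _ _ => Set.indicator {l} 1 k')).mul_right (w l)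
  refine h2.unique ?_
  have e : ∀ m, stageExp G k σ τ (fun l _ _ => w l) m =
      ∑ l, stageExp G k σ τ (fun k' _ _ => Set.indicator {l} 1 k') m * w l := fun m => by
    simp only [stageExp, ← integral_mul_const]
    rw [← integral_finsetSum _ fun l _ =>
      (integrable_stage G k σ τ (fun k' _ _ => Set.indicator {l} 1 k') m).mul_const (w l)]
    refine integral_congr_ae (ae_of_all _ fun ω => ?_)
    simp [Set.indicator_apply]
  convert! hasSum_disc G hlam k σ τ (fun l _ _ => w l) using 2 with m
  rw [e, Finset.mul_sum]
  exact Finset.sum_congr rfl fun l _ => by ring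

end Shapley

/-- Convergence at some t₁ in (t, lam₀) is absolute, and the terms at t₁ dominate those on (0, t₁)
since the exponents are nonnegative. -/
theorem IsPuiseuxOn.continuousAt {N : ℕ} {lam₀ : ℝ} {f : ℝ → ℝ} (h : IsPuiseuxOn N lam₀ f) {t : ℝ}
    (ht : t ∈ Set.Ioo (0 : ℝ) lam₀) : ContinuousAt f t := by
  obtain ⟨a, ha⟩ := h
  obtain ⟨t₁, h1, h2⟩ := exists_between ht.2
  have hs := (ha t₁ ⟨ht.1.trans h1, h2⟩).summable.norm
  have hc : ContinuousOn (fun t => ∑' m : ℕ, a m * t ^ ((m : ℝ) / (N : ℝ))) (Set.Ioo 0 t₁) := by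
    refine continuousOn_tsum (fun m => ?_) hs fun m s hs => ?_
    · exact continuousOn_const.mul (continuousOn_id.rpow_const fun s hs => Or.inl hs.1.ne')
    · rw [norm_mul, norm_mul]
      refine mul_le_mul_of_nonneg_left ?_ (norm_nonneg _)
      rw [Real.norm_of_nonneg (Real.rpow_nonneg hs.1.le _),
        Real.norm_of_nonneg (Real.rpow_nonneg (hs.1.trans hs.2).le _)]
      exact Real.rpow_le_rpow hs.1.le hs.2.le (by positivity)
  have hmem : Set.Ioo 0 t₁ ∈ nhds t := Ioo_mem_nhds ht.1 h1
  refine (hc.continuousAt hmem).congr ?_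
  filter_upwards [hmem] with s hs
  exact (ha s ⟨hs.1, hs.2.trans h2⟩).tsum_eq

/-! ### The two inequalities and the derivative of the value -/

namespace IsOptimalPuiseuxProfile

variable {K : Type u} {I : Type v} {J : Type w} [Fintype K] [Fintype I] [Fintype J]
  {G : Game K I J} {x1 : ℝ → K → stdSimplex ℝ I} {x2 : ℝ → K → stdSimplex ℝ J} {lam₀ : ℝ} {N : ℕ}

theorem value_le (hx : IsOptimalPuiseuxProfile G x1 x2 lam₀ N) {lam : ℝ}
    (hlam : lam ∈ Set.Ioc (0 : ℝ) 1) (k : K) (τ : Strategy2 K I J) :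
    value G lam k ≤ payoff G lam k (stat1 J (x1 lam)) τ :=
  (hx.optimal1 lam hlam k).value_le G hlam k τ

theorem le_value (hx : IsOptimalPuiseuxProfile G x1 x2 lam₀ N) {lam : ℝ}
    (hlam : lam ∈ Set.Ioc (0 : ℝ) 1) (k : K) (σ : Strategy1 K I J) :
    payoff G lam k σ (stat2 I (x2 lam)) ≤ value G lam k := by
  have neI : Nonempty I := by
    by_contra h
    rw [not_nonempty_iff] at h
    simpa using (x1 lam k).2.2
  have neJ : Nonempty J := by
    by_contra h
    rw [not_nonempty_iff] at h
    simpa using (x2 lam k).2.2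
  exact (hx.optimal2 lam hlam k).le_value G hlam k σ

theorem payoff_eq (hx : IsOptimalPuiseuxProfile G x1 x2 lam₀ N) {lam : ℝ}
    (hlam : lam ∈ Set.Ioc (0 : ℝ) 1) (k : K) :
    payoff G lam k (stat1 J (x1 lam)) (stat2 I (x2 lam)) = value G lam k :=
  (hx.le_value hlam k _).antisymm (hx.value_le hlam k _)

theorem value_ge_of_lt (hx : IsOptimalPuiseuxProfile G x1 x2 lam₀ N) (k : K) {lam lam' : ℝ}
    (h' : 0 < lam') (hlt : lam' < lam) (h1 : lam ≤ 1) :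
    (lam' * (1 - lam) / (lam * (1 - lam'))) * value G lam k
      + ((lam - lam') / (lam * (1 - lam'))) * (occ G x1 x2 lam lam lam' k ⬝ᵥ value G lam')
      ≤ value G lam' k := by
  have hlam : lam ∈ Set.Ioc (0 : ℝ) 1 := ⟨h'.trans hlt, h1⟩
  have hlam' : lam' ∈ Set.Ioc (0 : ℝ) 1 := ⟨h', hlt.le.trans h1⟩
  rw [occ_dotProduct G x1 x2 hlam]
  refine le_trans ?_ (disc_add_disc_le G hlam (x1 lam) (x2 lam') h' hlt G.g (value G lam')
    (fun k => mixed_bellman_le G hlam' (x1 lam') (x2 lam') (hx.payoff_eq hlam')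
      (hx.le_value hlam') k _) k)
  gcongr
  · exact div_nonneg (mul_nonneg h'.le (sub_nonneg.2 h1))
      (mul_nonneg hlam.1.le (sub_nonneg.2 hlam'.2))
  · exact hx.value_le hlam k _

theorem value_le_of_lt (hx : IsOptimalPuiseuxProfile G x1 x2 lam₀ N) (k : K) {lam lam' : ℝ}
    (h' : 0 < lam') (hlt : lam' < lam) (h1 : lam ≤ 1) :
    value G lam' k ≤ (lam' * (1 - lam) / (lam * (1 - lam'))) * value G lam k
      + ((lam - lam') / (lam * (1 - lam'))) *
        (occ G x1 x2 lam lam' lam k ⬝ᵥ value G lam') := by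
  have hlam : lam ∈ Set.Ioc (0 : ℝ) 1 := ⟨h'.trans hlt, h1⟩
  have hlam' : lam' ∈ Set.Ioc (0 : ℝ) 1 := ⟨h', hlt.le.trans h1⟩
  rw [occ_dotProduct G x1 x2 hlam]
  refine (le_disc_add_disc G hlam (x1 lam') (x2 lam) h' hlt G.g (value G lam')
    (fun k => le_mixed_bellman G hlam' (x1 lam') (x2 lam') (hx.payoff_eq hlam')
      (hx.value_le hlam') k _) k).trans ?_
  gcongr
  · exact div_nonneg (mul_nonneg h'.le (sub_nonneg.2 h1))
      (mul_nonneg hlam.1.le (sub_nonneg.2 hlam'.2))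
  · exact hx.le_value hlam k _

theorem tendsto_disc (hx : IsOptimalPuiseuxProfile G x1 x2 lam₀ N) {lam : ℝ}
    (hlam : lam ∈ Set.Ioo (0 : ℝ) lam₀) {ι : Type*} {f : Filter ι} {p q r : ι → ℝ}
    (hp : Filter.Tendsto p f (nhds lam)) (hq : Filter.Tendsto q f (nhds lam))
    (hr : Filter.Tendsto r f (nhds lam)) (c : K → I → J → ℝ) (k : K) :
    Filter.Tendsto (fun n => disc G (p n) k (stat1 J (x1 (q n))) (stat2 I (x2 (r n))) c) f
      (nhds (disc G lam k (stat1 J (x1 lam)) (stat2 I (x2 lam)) c)) := by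
  have h1 := hlam.2.trans_le hx.lam₀_mem.2
  exact StochGame.tendsto_disc G ⟨hlam.1, h1.le⟩ hp
    ((hp.eventually (gt_mem_nhds h1)).mono fun _ h => h.le)
    (fun k i => ((hx.puiseux1 k i).continuousAt hlam).tendsto.comp hq)
    (fun k j => ((hx.puiseux2 k j).continuousAt hlam).tendsto.comp hr) c k

theorem tendsto_occ (hx : IsOptimalPuiseuxProfile G x1 x2 lam₀ N) {lam : ℝ}
    (hlam : lam ∈ Set.Ioo (0 : ℝ) lam₀) {ι : Type*} {f : Filter ι} {p q r : ι → ℝ}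
    (hp : Filter.Tendsto p f (nhds lam)) (hq : Filter.Tendsto q f (nhds lam))
    (hr : Filter.Tendsto r f (nhds lam)) (k l : K) :
    Filter.Tendsto (fun n => occ G x1 x2 (p n) (q n) (r n) k l) f
      (nhds (occ G x1 x2 lam lam lam k l)) :=
  hx.tendsto_disc hlam hp hq hr (fun k' _ _ => Set.indicator {l} 1 k') k

theorem continuousAt_value (hx : IsOptimalPuiseuxProfile G x1 x2 lam₀ N) {lam : ℝ}
    (hlam : lam ∈ Set.Ioo (0 : ℝ) lam₀) (k : K) : ContinuousAt (fun t => value G t k) lam := by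
  have h := hx.tendsto_disc hlam Filter.tendsto_id Filter.tendsto_id Filter.tendsto_id G.g k
  have hmem : ∀ t ∈ Set.Ioo (0 : ℝ) lam₀, disc G t k (stat1 J (x1 t)) (stat2 I (x2 t)) G.g
      = value G t k := fun t ht => hx.payoff_eq ⟨ht.1, ht.2.le.trans hx.lam₀_mem.2⟩ k
  rw [hmem lam hlam] at h
  refine h.congr' ?_
  filter_upwards [Ioo_mem_nhds hlam.1 hlam.2] with t ht
  exact hmem t ht

theorem hasDerivAt_value (hx : IsOptimalPuiseuxProfile G x1 x2 lam₀ N) {lam : ℝ}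
    (hlam : lam ∈ Set.Ioo (0 : ℝ) lam₀) (k : K) :
    HasDerivAt (fun t : ℝ => value G t k)
      ((1 / (lam * (1 - lam))) *
        (value G lam k - occ G x1 x2 lam lam lam k ⬝ᵥ value G lam)) lam := by
  have h1 : lam < 1 := hlam.2.trans_le hx.lam₀_mem.2
  rw [hasDerivAt_iff_tendsto_slope]
  -- Ordering t and lam by `max` and `min` treats the left and right difference quotients together.
  have hT : Filter.Tendsto (fun t => max t lam) (nhdsWithin lam {lam}ᶜ) (nhds lam) := by
    have : Continuous fun t : ℝ => max t lam := by fun_prop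
    simpa using (this.tendsto lam).mono_left (nhdsWithin_le_nhds (s := {lam}ᶜ))
  have hS : Filter.Tendsto (fun t => min t lam) (nhdsWithin lam {lam}ᶜ) (nhds lam) := by
    have : Continuous fun t : ℝ => min t lam := by fun_prop
    simpa using (this.tendsto lam).mono_left (nhdsWithin_le_nhds (s := {lam}ᶜ))
  have hlim : ∀ q r : ℝ → ℝ, Filter.Tendsto q (nhdsWithin lam {lam}ᶜ) (nhds lam) →
      Filter.Tendsto r (nhdsWithin lam {lam}ᶜ) (nhds lam) →
      Filter.Tendsto (fun t => (1 / (max t lam * (1 - min t lam))) * (value G (max t lam) k -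
        occ G x1 x2 (max t lam) (q t) (r t) k ⬝ᵥ value G (min t lam))) (nhdsWithin lam {lam}ᶜ)
        (nhds ((1 / (lam * (1 - lam))) *
          (value G lam k - occ G x1 x2 lam lam lam k ⬝ᵥ value G lam))) := fun q r hq hr => by
    refine (tendsto_const_nhds.div (hT.mul (hS.const_sub 1))
      (mul_pos hlam.1 (sub_pos.2 h1)).ne').mul
      (((hx.continuousAt_value hlam k).tendsto.comp hT).sub ?_)
    exact tendsto_finsetSum _ fun l _ => (hx.tendsto_occ hlam hT hq hr k l).mul
      ((hx.continuousAt_value hlam l).tendsto.comp hS)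
  have hbd : ∀ᶠ t in nhdsWithin lam {lam}ᶜ, t ∈ Set.Ioo (0 : ℝ) lam₀ ∧ t ≠ lam :=
    (Filter.Eventually.filter_mono nhdsWithin_le_nhds (Ioo_mem_nhds hlam.1 hlam.2)).and
      self_mem_nhdsWithin
  have hslope : ∀ s t : ℝ, 0 < s → s < t → t < 1 →
      (1 / (t * (1 - s))) * (value G t k - occ G x1 x2 t s t k ⬝ᵥ value G s)
          ≤ slope (fun t => value G t k) s t ∧
        slope (fun t => value G t k) s t
          ≤ (1 / (t * (1 - s))) * (value G t k - occ G x1 x2 t t s k ⬝ᵥ value G s) := by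
    intro s t hs hst ht
    have hlo := hx.value_ge_of_lt k hs hst ht.le
    have hup := hx.value_le_of_lt k hs hst ht.le
    have hts : 0 < t - s := sub_pos.2 hst
    have hpos : 0 < t * (1 - s) := mul_pos (hs.trans hst) (by linarith)
    -- Written this way, the first weight makes t - s a common factor of each bound on v_t - v_s.
    have hw : s * (1 - t) / (t * (1 - s)) = 1 - (t - s) * (1 / (t * (1 - s))) := by
      rw [mul_one_div, eq_sub_iff_add_eq, ← add_div, div_eq_one_iff_eq hpos.ne']
      ring
    rw [hw, div_eq_mul_one_div (t - s)] at hlo hup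
    rw [slope_def_field, div_le_iff₀ hts, le_div_iff₀ hts]
    constructor <;> linarith
  refine tendsto_of_tendsto_of_tendsto_of_le_of_le' (hlim _ _ hS hT) (hlim _ _ hT hS) ?_ ?_
  all_goals
    filter_upwards [hbd] with t ht
    rcases lt_or_gt_of_ne ht.2 with h | h
    · rw [max_eq_right h.le, min_eq_left h.le, slope_comm]
      first
        | exact (hslope t lam ht.1.1 h h1).1
        | exact (hslope t lam ht.1.1 h h1).2
    · rw [max_eq_left h.le, min_eq_right h.le]
      have ht1 := ht.1.2.trans_le hx.lam₀_mem.2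
      first
        | exact (hslope lam t hlam.1 h ht1).1
        | exact (hslope lam t hlam.1 h ht1).2

end IsOptimalPuiseuxProfile

end StochGame

end

theorem mainTheorem5 {K I J : Type*} [Fintype K] [Fintype I] [Fintype J]
    (G : StochGame.Game K I J)
    (x1 : ℝ → K → stdSimplex ℝ I) (x2 : ℝ → K → stdSimplex ℝ J) (lam₀ : ℝ) (N : ℕ)
    (hx : StochGame.IsOptimalPuiseuxProfile G x1 x2 lam₀ N) (k : K) :
    (∀ lam lam' : ℝ, 0 < lam' → lam' < lam → lam ≤ 1 →
      (lam' * (1 - lam) / (lam * (1 - lam'))) * StochGame.value G lam k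
          + ((lam - lam') / (lam * (1 - lam'))) *
            (StochGame.occ G x1 x2 lam lam lam' k ⬝ᵥ StochGame.value G lam')
        ≤ StochGame.value G lam' k ∧
      StochGame.value G lam' k ≤
        (lam' * (1 - lam) / (lam * (1 - lam'))) * StochGame.value G lam k
          + ((lam - lam') / (lam * (1 - lam'))) *
            (StochGame.occ G x1 x2 lam lam' lam k ⬝ᵥ StochGame.value G lam') ∧
      (lam < 1 → 0 < lam' * (1 - lam) / (lam * (1 - lam'))) ∧
      0 < (lam - lam') / (lam * (1 - lam')) ∧
      lam' * (1 - lam) / (lam * (1 - lam')) + (lam - lam') / (lam * (1 - lam')) = 1) ∧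
    (∀ lam ∈ Set.Ioo (0 : ℝ) lam₀,
      HasDerivAt (fun t : ℝ => StochGame.value G t k)
        ((1 / (lam * (1 - lam))) *
          (StochGame.value G lam k
            - StochGame.occ G x1 x2 lam lam lam k ⬝ᵥ StochGame.value G lam)) lam) := by
  refine ⟨fun lam lam' h' hlt h1 => ?_, fun lam hlam => hx.hasDerivAt_value hlam k⟩
  have hpos : 0 < lam * (1 - lam') := mul_pos (h'.trans hlt) (by linarith)
  refine ⟨hx.value_ge_of_lt k h' hlt h1, hx.value_le_of_lt k h' hlt h1,
    fun h => div_pos (mul_pos h' (sub_pos.2 h)) hpos, div_pos (sub_pos.2 hlt) hpos, ?_⟩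
  rw [← add_div, div_eq_one_iff_eq hpos.ne']
  ring
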